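/- Let $\mathsf k$ be a field and let $q, r\ge 1$ be integers. Let $S=\mathsf k[x_A : \emptyset\ne A\subseteq [q]]$, where $[q]=\{1,\dots,q\}$; for $i\in[q]$ let $\epsilon_i=\prod_{A\ni i}x_A$, and let $\mathcal E_q=(\epsilon_1,\dots,\epsilon_q)\subseteq S$ be the $q$-extremal ideal. For $\mathbf a=(a_1,\dots,a_q)\in\mathbb N^q$ write $|\mathbf a|=a_1+\cdots+a_q$ and $\boldsymbol\epsilon^{\mathbf a}=\epsilon_1^{a_1}\cdots\epsilon_q^{a_q}$. The Taylor complex of a monomial ideal is the full simplex on its minimal monomial generators, each face being labelled by the least common multiple of its vertices; the Scarf complex consists of the faces of the Taylor complex that do not share their label with another face. Let $\mathbb S^r_q$ be the Scarf complex of $\mathcal E_q^{\,r}$. For $s \ge 1$ let $U^s_q=\{\boldsymbol\epsilon^{\mathbf c}: \mathbf c\in\{0,1\}^q,\ |\mathbf c|=s\}$. For $|\mathbf a|<r$ put $\boldsymbol\epsilon^{\mathbf a}U_q^{r-|\mathbf a|}=\{\boldsymbol\epsilon^{\mathbf a}u: u\in U_q^{r-|\mathbf a|}\}$. For $q\ge2$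 let $\mathbb U^r_q$ be the simplicial complex whose faces are the subsets of the sets $\boldsymbol\epsilon^{\mathbf a}U_q^{r-|\mathbf a|}$ with $\mathbf a\in\mathbb N^q$ and $r-q<|\mathbf a|<r$; for $q=1$ let $\mathbb U^r_1$ be the simplex on the single vertex $\epsilon_1^r$. Then for every $\mathbf a\in\mathbb N^q$ with $r-q<|\mathbf a|<r$, the set $\boldsymbol\epsilon^{\mathbf a}U_q^{r-|\mathbf a|}$ is a facet of $\mathbb S^r_q$. In particular, every facet of $\mathbb U^r_q$ is a facet of $\mathbb S^r_q$, and $\mathbb U^r_q\subseteq\mathbb S^r_q$. Furthermore, for every $i\ge0$, the number $f_i$ of $i$-dimensional faces of $\mathbb U^r_q$ satisfies $$f_i\le\beta_i^S(\mathcal E_q^{\,r}),$$ where $\beta_i^S(\mathcal E_q^{\,r})=\dim_{\mathsf k}\operatorname{Tor}_i^S(\mathsf k,\mathcal E_q^{\,r})$ is the $i$-th Betti number, with $\mathsf k=S/(x_A : \emptyset\ne A\subseteq[q])$. -/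

import Mathlib

namespace ExtremalScarf

open CategoryTheory

/-! ### Simplicial complexes -/

/-- A facet of a simplicial complex: a face that is maximal under inclusion. -/
def IsFacet {V : Type*} (K : PreAbstractSimplicialComplex V) (s : Finset V) : Prop :=
  Maximal (fun t => t ∈ K.faces) s

/-- The entry `f_i` of the `f`-vector of a simplicial complex: the number of faces of
dimension `i`, that is, of faces with `i + 1` vertices. -/
noncomputable def fNumber {V : Type*} (K : PreAbstractSimplicialComplex V) (i : ℕ) : ℕ∞ :=
  {s : Finset V | s ∈ K.faces ∧ s.card = i + 1}.encard

/-- The simplicial complex generated by a collection of finite sets: its faces are the nonempty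
subsets of the members of the collection. -/
def generatedBy {V : Type*} (𝓕 : Set (Finset V)) : PreAbstractSimplicialComplex V where
  faces := {s | s.Nonempty ∧ ∃ F ∈ 𝓕, s ⊆ F}
  isRelLowerSet_faces := by
    rintro s ⟨hs, F, hF, hsF⟩
    exact ⟨hs, fun t hts ht => ⟨ht, F, hF, Finset.Subset.trans hts hsF⟩⟩

/-! ### Taylor and Scarf complexes, Betti numbers

A monomial in the variables `σ` is represented by its exponent vector `σ →₀ ℕ`, so that
divisibility is `≤` and the least common multiple is the supremum. -/

/-- The minimal monomial generators of a monomial ideal: the monomials of the ideal that are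
minimal with respect to divisibility. -/
def minGens {σ k : Type*} [CommSemiring k] (I : Ideal (MvPolynomial σ k)) : Set (σ →₀ ℕ) :=
  {m | Minimal (fun m' => MvPolynomial.monomial m' (1 : k) ∈ I) m}

/-- The monomial label of a set of monomials: their least common multiple. -/
noncomputable def label {σ : Type*} (s : Finset (σ →₀ ℕ)) : σ →₀ ℕ := s.sup id

/-- The Taylor complex of a monomial ideal: the full simplex on its minimal generators. -/
def taylorComplex {σ k : Type*} [CommSemiring k] (I : Ideal (MvPolynomial σ k)) :
    PreAbstractSimplicialComplex (σ →₀ ℕ) where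
  faces := {s | s.Nonempty ∧ (s : Set (σ →₀ ℕ)) ⊆ minGens I}
  isRelLowerSet_faces := by
    rintro s ⟨hs, hsI⟩
    exact ⟨hs, fun t hts ht => ⟨ht, fun x hx => hsI (hts hx)⟩⟩

/-- The Scarf complex of a monomial ideal: the faces of the Taylor complex that do not share their
monomial label with another face. -/
def scarfComplex {σ k : Type*} [CommSemiring k] (I : Ideal (MvPolynomial σ k)) :
    PreAbstractSimplicialComplex (σ →₀ ℕ) where
  faces := {s | s ∈ (taylorComplex I).faces ∧
    ∀ t ∈ (taylorComplex I).faces, label t = label s → t = s}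
  isRelLowerSet_faces := by
    classical
    rintro s ⟨⟨hs, hsI⟩, huniq⟩
    refine ⟨hs, fun u hus hu => ⟨⟨hu, fun x hx => hsI (hus hx)⟩, ?_⟩⟩
    rintro t ⟨ht, htI⟩ htu
    have hmono : ∀ {x y : Finset (σ →₀ ℕ)}, x ⊆ y → label x ≤ label y :=
      fun h => Finset.sup_mono h
    have hts : t ⊆ s := by
      have h : s ∪ t = s := by
        refine huniq _ ⟨hs.mono Finset.subset_union_left, ?_⟩ ?_
        · intro x hx
          rcases Finset.mem_union.mp hx with hx | hx
          exacts [hsI hx, htI hx]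
        · unfold label at *
          rw [Finset.sup_union, htu, sup_eq_left]
          exact Finset.sup_mono hus
      exact Finset.union_eq_left.mp h
    -- two nonempty subsets of `s` with equal labels contain one another
    have key : ∀ x y : Finset (σ →₀ ℕ), x ⊆ s → y ⊆ s → x.Nonempty → label x = label y → y ⊆ x := by
      intro x y hxs hys hx hxy v hvy
      by_contra hvx
      have hxe : x ⊆ s.erase v := Finset.subset_erase.mpr ⟨hxs, hvx⟩
      have h : s.erase v = s := by
        refine huniq _ ⟨hx.mono hxe, fun z hz => hsI (Finset.mem_of_mem_erase hz)⟩ ?_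
        apply le_antisymm (hmono (Finset.erase_subset _ _))
        refine Finset.sup_le fun z hz => ?_
        by_cases hzv : z = v
        · subst hzv
          calc id z ≤ label y := Finset.le_sup (f := id) hvy
            _ = label x := hxy.symm
            _ ≤ _ := hmono hxe
        · exact Finset.le_sup (f := id) (Finset.mem_erase.mpr ⟨hzv, hz⟩)
      exact (Finset.erase_eq_self.mp h) (hys hvy)
    exact Finset.Subset.antisymm (key u t hus hts hu htu.symm) (key t u hts hus ht htu)

/-- The `i`-th (total) Betti number of an ideal `I` of a polynomial ring `S` over a field `k`:
the dimension over `k` of `Tor_i^S (k, I)`, where `k` is the quotient of `S` by the ideal generated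
by all variables. It is the rank of the `i`-th module in a minimal free resolution of `I`. -/
noncomputable def betti {σ : Type} {k : Type*} [Field k] (i : ℕ)
    (I : Ideal (MvPolynomial σ k)) : ℕ :=
  Module.finrank k
    ((ModuleCat.restrictScalars (algebraMap k (MvPolynomial σ k))).obj
      (((Tor (ModuleCat (MvPolynomial σ k)) i).obj
        (ModuleCat.of (MvPolynomial σ k)
          (MvPolynomial σ k ⧸ Ideal.span (Set.range (MvPolynomial.X (R := k) (σ := σ)))))).obj
        (ModuleCat.of (MvPolynomial σ k) I)))

/-! ### Extremal ideals -/

/-- The index set of the variables `x_A`: the nonempty subsets `A` of `[q]`. -/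
abbrev Var (q : ℕ) : Type := {A : Finset (Fin q) // A.Nonempty}

/-- The square-free monomial `ε_i`: the product of the variables `x_A` with `i ∈ A`. -/
noncomputable def epsilon (k : Type*) [CommSemiring k] (q : ℕ) (i : Fin q) :
    MvPolynomial (Var q) k :=
  ∏ A : Var q with i ∈ A.1, MvPolynomial.X A

/-- The extremal ideal `𝓔_q = (ε_1, …, ε_q)`. -/
noncomputable def extremalIdeal (k : Type*) [CommSemiring k] (q : ℕ) :
    Ideal (MvPolynomial (Var q) k) :=
  Ideal.span (Set.range (epsilon k q))

/-- The exponent vector of the monomial `ε^a = ε_1 ^ a_1 ⋯ ε_q ^ a_q`. -/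
noncomputable def epsExp {q : ℕ} (a : Fin q → ℕ) : Var q →₀ ℕ :=
  ∑ i, a i • ∑ A : Var q with i ∈ A.1, Finsupp.single A 1

/-- The exponent vector `epsExp a` is that of `ε^a`. -/
theorem prod_epsilon_pow (k : Type*) [CommSemiring k] {q : ℕ} (a : Fin q → ℕ) :
    ∏ i, epsilon k q i ^ a i = MvPolynomial.monomial (epsExp a) (1 : k) := by
  simp only [epsilon, epsExp, MvPolynomial.monomial_sum_one, MvPolynomial.X]
  simp only [← MvPolynomial.monomial_sum_one, MvPolynomial.monomial_pow, one_pow]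

/-! ### The complex `𝕌_q^r` -/

/-- The set `U_q^r` of square-free products of `r` of the `ε_i`: all `ε^c` with `|c| = r` and
all `c_i ∈ {0, 1}`. -/
noncomputable def squareFreeFace (q r : ℕ) : Finset (Var q →₀ ℕ) :=
  ({c ∈ Finset.piAntidiag Finset.univ r | ∀ i, c i ≤ 1} : Finset (Fin q → ℕ)).image epsExp

/-- The set `ε^a · U_q^(r - |a|)`, meant for `|a| < r`. -/
noncomputable def shiftedFace {q : ℕ} (r : ℕ) (a : Fin q → ℕ) : Finset (Var q →₀ ℕ) :=
  (squareFreeFace q (r - ∑ i, a i)).image (fun m => epsExp a + m)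

/-- The simplicial complex `𝕌_q^r`. For `q ≠ 1` it is generated by the sets `ε^a · U_q^(r - |a|)`
with `r - q < |a| < r`; for `q = 1` it consists of the single vertex `ε_1 ^ r`. -/
noncomputable def uComplex (q r : ℕ) : PreAbstractSimplicialComplex (Var q →₀ ℕ) :=
  generatedBy
    (if q = 1 then {{epsExp fun _ => r}}
    else {F | ∃ a : Fin q → ℕ, r < ∑ i, a i + q ∧ ∑ i, a i < r ∧ F = shiftedFace r a})

end ExtremalScarf

/-! The exponent of `x_A` in `ε^a` is the partial sum of `a` over `A`, so divisibility compares
partial sums over all nonempty `A`. Put `s = r - |a|`, so `0 < s < q`. The vertices of the face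
attached to `a` are the `ε^(a + 1_C)` with `|C| = s`, and its label has `x_A`-exponent at most `∑_A
a + min(|A|, s)`. Testing on singletons and their complements shows that a generator dividing the
label is already a vertex (`mem_shiftedFace_of_le_label`). The vertex of `C` is indispensable, since
it alone reaches exponent `∑_C a + s` at `x_C`. Hence the face is Scarf. If a further generator
`ε^b` is added, some `C` satisfies `∑_C b ≥ ∑_C a + s`, and the vertex of `C` becomes redundant, by
`exists_swap` at the variables other than `x_C`. Hence the face is a facet.

The bound on `f_i` holds because Scarf faces survive in every free resolution. Here Tor is computed
from a large Taylor resolution whose basis in degree `i` consists of all `(i+1)`-tuples of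
generators, with repetitions and in any order; it is a simplicial module and needs no ordering of
the generators. Modulo the variables, enumerations of Scarf faces are cycles, and determinantal
functionals dual to them kill boundaries, so distinct Scarf faces give independent homology classes
(`card_scarfTuple_le_betti`). -/

namespace ExtremalScarf

open MvPolynomial

/-! ### The Taylor complex on tuples and its contracting homotopy. -/

section Taylor

variable {σ ι : Type} (k : Type*) [Field k] (g : ι → σ →₀ ℕ)

/-- The least common multiple of a tuple of monomials. -/
noncomputable def tupleLabel {n : ℕ} (t : Fin n → ι) : σ →₀ ℕ :=
  Finset.univ.sup fun i => g (t i)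

theorem le_tupleLabel {n : ℕ} (t : Fin n → ι) (i : Fin n) : g (t i) ≤ tupleLabel g t :=
  Finset.le_sup (f := fun i => g (t i)) (Finset.mem_univ i)

theorem tupleLabel_le_iff {n : ℕ} (t : Fin n → ι) (m : σ →₀ ℕ) :
    tupleLabel g t ≤ m ↔ ∀ i, g (t i) ≤ m := by
  simp [tupleLabel]

theorem tupleLabel_comp_le {m n : ℕ} (t : Fin n → ι) (f : Fin m → Fin n) :
    tupleLabel g (t ∘ f) ≤ tupleLabel g t :=
  (tupleLabel_le_iff g _ _).2 fun i => le_tupleLabel g t (f i)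

/-- The free module on the `n`-tuples of generators. -/
abbrev TupleModule (σ ι : Type) (k : Type*) [Field k] (n : ℕ) : Type _ :=
  (Fin n → ι) →₀ MvPolynomial σ k

/-- The map of tuple modules induced by a map of positions, homogenized by the labels. -/
noncomputable def tupleMap {m n : ℕ} (f : Fin m → Fin n) :
    TupleModule σ ι k n →ₗ[MvPolynomial σ k] TupleModule σ ι k m :=
  Finsupp.linearCombination _ fun t =>
    Finsupp.single (t ∘ f) (monomial (tupleLabel g t - tupleLabel g (t ∘ f)) 1)

theorem tupleMap_single_one {m n : ℕ} (f : Fin m → Fin n) (t : Fin n → ι) :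
    tupleMap k g f (Finsupp.single t 1) =
      Finsupp.single (t ∘ f) (monomial (tupleLabel g t - tupleLabel g (t ∘ f)) 1) := by
  simp [tupleMap]

theorem tupleMap_single_monomial {m n : ℕ} (f : Fin m → Fin n) (t : Fin n → ι) (u : σ →₀ ℕ) :
    tupleMap k g f (Finsupp.single t (monomial u 1)) =
      Finsupp.single (t ∘ f) (monomial (u + tupleLabel g t - tupleLabel g (t ∘ f)) 1) := by
  rw [add_tsub_assoc_of_le (tupleLabel_comp_le g t f)]
  simp [tupleMap, monomial_mul]

theorem tupleMap_id {n : ℕ} : tupleMap k g (id : Fin n → Fin n) = LinearMap.id := by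
  refine Finsupp.lhom_ext' fun t => LinearMap.ext_ring ?_
  simp [tupleMap_single_one]

theorem tupleMap_comp {l m n : ℕ} (f : Fin m → Fin n) (f' : Fin l → Fin m) :
    tupleMap k g (f ∘ f') = tupleMap k g f' ∘ₗ tupleMap k g f := by
  refine Finsupp.lhom_ext' fun t => LinearMap.ext_ring ?_
  simp only [LinearMap.coe_comp, Function.comp_apply, Finsupp.lsingle_apply, tupleMap_single_one,
    tupleMap_single_monomial]
  rw [tsub_add_cancel_of_le (tupleLabel_comp_le g t f)]
  rfl

/-- The differential of the Taylor complex on tuples. -/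
noncomputable def tupleD (n : ℕ) :
    TupleModule σ ι k (n + 1) →ₗ[MvPolynomial σ k] TupleModule σ ι k n :=
  ∑ i : Fin (n + 1), (-1 : ℤ) ^ (i : ℕ) • tupleMap k g i.succAbove

theorem tupleD_apply (n : ℕ) (x : TupleModule σ ι k (n + 1)) :
    tupleD k g n x = ∑ i : Fin (n + 1), (-1 : ℤ) ^ (i : ℕ) • tupleMap k g i.succAbove x := by
  simp [tupleD, LinearMap.sum_apply]

variable (v : (σ →₀ ℕ) → ι)

/-- The contracting homotopy of the Taylor complex that prepends, in multidegree `m`, the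
generator `v m`. -/
noncomputable def tupleCone (n : ℕ) : TupleModule σ ι k n →ₗ[k] TupleModule σ ι k (n + 1) :=
  Finsupp.lsum k fun t => (basisMonomials σ k).constr k fun u =>
    Finsupp.single (Fin.cons (v (u + tupleLabel g t)) t : Fin (n + 1) → ι)
      (monomial (u + tupleLabel g t -
        tupleLabel g (Fin.cons (v (u + tupleLabel g t)) t : Fin (n + 1) → ι)) 1)

theorem tupleCone_single (n : ℕ) (t : Fin n → ι) (u : σ →₀ ℕ) :
    tupleCone k g v n (Finsupp.single t (monomial u 1)) =
      Finsupp.single (Fin.cons (v (u + tupleLabel g t)) t : Fin (n + 1) → ι)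
        (monomial (u + tupleLabel g t -
          tupleLabel g (Fin.cons (v (u + tupleLabel g t)) t : Fin (n + 1) → ι)) 1) := by
  rw [tupleCone, Finsupp.lsum_single]
  exact (basisMonomials σ k).constr_basis k _ u

-- Prepending a divisor of the multidegree `u + tupleLabel g t` keeps the label a divisor of it, so
-- the truncated subtraction in `tupleCone` is an honest quotient of monomials.
variable {v} in
theorem tupleLabel_cons_le (hv : ∀ m, (∃ i, g i ≤ m) → g (v m) ≤ m) {n : ℕ} (t : Fin n → ι)
    (u : σ →₀ ℕ) (h : ∃ i, g i ≤ u + tupleLabel g t) :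
    tupleLabel g (Fin.cons (v (u + tupleLabel g t)) t : Fin (n + 1) → ι) ≤
      u + tupleLabel g t := by
  rw [tupleLabel_le_iff]
  refine Fin.cases ?_ fun i => ?_
  · simpa using hv _ h
  · simpa using (le_tupleLabel g t i).trans le_add_self

variable {v} in
theorem tupleMap_zero_cone (hv : ∀ m, (∃ i, g i ≤ m) → g (v m) ≤ m) {n : ℕ} (t : Fin n → ι)
    (u : σ →₀ ℕ) (h : ∃ i, g i ≤ u + tupleLabel g t) :
    tupleMap k g (Fin.succAbove 0) (tupleCone k g v n (Finsupp.single t (monomial u 1))) =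
      Finsupp.single t (monomial u 1) := by
  rw [tupleCone_single, tupleMap_single_monomial, tsub_add_cancel_of_le
    (tupleLabel_cons_le g hv t u h)]
  have : (Fin.cons (v (u + tupleLabel g t)) t : Fin (n + 1) → ι) ∘ Fin.succAbove 0 = t := by
    ext i; simp
  rw [this, add_tsub_cancel_right]

variable {v} in
theorem tupleMap_succ_cone (hv : ∀ m, (∃ i, g i ≤ m) → g (v m) ≤ m) {n : ℕ}
    (t : Fin (n + 1) → ι) (u : σ →₀ ℕ) (i : Fin (n + 1)) :
    tupleMap k g i.succ.succAbove (tupleCone k g v _ (Finsupp.single t (monomial u 1))) =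
      tupleCone k g v _ (tupleMap k g i.succAbove (Finsupp.single t (monomial u 1))) := by
  have h : ∃ i, g i ≤ u + tupleLabel g t := ⟨t 0, (le_tupleLabel g t 0).trans le_add_self⟩
  rw [tupleCone_single, tupleMap_single_monomial, tsub_add_cancel_of_le
    (tupleLabel_cons_le g hv t u h), tupleMap_single_monomial, tupleCone_single,
    tsub_add_cancel_of_le ((tupleLabel_comp_le g t _).trans le_add_self)]
  have : (Fin.cons (v (u + tupleLabel g t)) t : Fin (n + 2) → ι) ∘ i.succ.succAbove =
      Fin.cons (v (u + tupleLabel g t)) (t ∘ i.succAbove) := by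
    ext j
    refine Fin.cases ?_ (fun j => ?_) j <;> simp
  rw [this]

-- Face `0` undoes the cone, while face `i + 1` commutes with it and carries the opposite sign to
-- face `i`, so everything else cancels. The homotopy is only `k`-linear, because the prepended
-- generator depends on the multidegree. Tuples of positive length always have a generator dividing
-- their multidegree, namely `t 0`.
variable {v} in
theorem tupleD_cone (hv : ∀ m, (∃ i, g i ≤ m) → g (v m) ≤ m) {n : ℕ}
    (x : TupleModule σ ι k (n + 1)) :
    tupleD k g (n + 1) (tupleCone k g v _ x) + tupleCone k g v _ (tupleD k g n x) = x := by
  suffices H : (tupleD k g (n + 1)).restrictScalars k ∘ₗ tupleCone k g v _ +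
      tupleCone k g v _ ∘ₗ (tupleD k g n).restrictScalars k = LinearMap.id from
    LinearMap.congr_fun H x
  refine Finsupp.lhom_ext' fun t => (basisMonomials σ k).ext fun u => ?_
  have h : ∃ i, g i ≤ u + tupleLabel g t := ⟨t 0, (le_tupleLabel g t 0).trans le_add_self⟩
  simp only [coe_basisMonomials, LinearMap.coe_comp, Function.comp_apply, Finsupp.lsingle_apply,
    LinearMap.add_apply, LinearMap.coe_restrictScalars, tupleD_apply, LinearMap.id_apply]
  rw [Fin.sum_univ_succ, tupleMap_zero_cone k g hv t u h]
  simp only [tupleMap_succ_cone k g hv, map_sum, map_zsmul, Fin.val_succ, pow_succ, Fin.val_zero]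
  simp

theorem exists_divisor_selector [Nonempty ι] :
    ∃ v : (σ →₀ ℕ) → ι, ∀ m, (∃ i, g i ≤ m) → g (v m) ≤ m := by
  classical
  refine ⟨fun m => if h : ∃ i, g i ≤ m then h.choose else Classical.arbitrary ι, fun m h => ?_⟩
  simpa [h] using h.choose_spec

theorem exists_of_tupleD_eq_zero {n : ℕ} (x : TupleModule σ ι k (n + 1))
    (hx : tupleD k g n x = 0) : ∃ y, tupleD k g (n + 1) y = x := by
  rcases isEmpty_or_nonempty ι with h | h
  · exact ⟨0, Subsingleton.elim _ _⟩
  · obtain ⟨v, hv⟩ := exists_divisor_selector g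
    exact ⟨tupleCone k g v _ x, by simpa [hx] using tupleD_cone k g hv x⟩

/-- The augmentation of the Taylor complex, sending a generator to its monomial. -/
noncomputable def tupleAug : TupleModule σ ι k 1 →ₗ[MvPolynomial σ k] MvPolynomial σ k :=
  Finsupp.linearCombination _ fun t => monomial (g (t 0)) 1

/-- Identifying the augmentation with the differential to the empty tuple makes exactness at degree
zero an instance of `exists_of_tupleD_eq_zero`. -/
theorem tupleD_zero (x : TupleModule σ ι k 1) :
    tupleD k g 0 x = Finsupp.single default (tupleAug k g x) := by
  suffices H : tupleD k g 0 = Finsupp.lsingle default ∘ₗ tupleAug k g from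
    LinearMap.congr_fun H x
  refine Finsupp.lhom_ext' fun t => LinearMap.ext_ring ?_
  simp only [LinearMap.coe_comp, Function.comp_apply, Finsupp.lsingle_apply, tupleD_apply,
    tupleMap_single_one, tupleAug, Finsupp.linearCombination_single, one_smul]
  simp [tupleLabel, bot_eq_zero, Subsingleton.elim _ (default : Fin 0 → ι)]

theorem tupleAug_tupleD (x : TupleModule σ ι k 2) : tupleAug k g (tupleD k g 1 x) = 0 := by
  suffices H : tupleAug k g ∘ₗ tupleD k g 1 = 0 from LinearMap.congr_fun H x
  refine Finsupp.lhom_ext' fun t => LinearMap.ext_ring ?_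
  have h (i : Fin 2) : tupleLabel g t - tupleLabel g (t ∘ i.succAbove) + g (t (i.succAbove 0)) =
      tupleLabel g t := by
    convert tsub_add_cancel_of_le (tupleLabel_comp_le g t i.succAbove)
    simp [tupleLabel]
  simp only [LinearMap.coe_comp, Function.comp_apply, Finsupp.lsingle_apply, tupleD_apply,
    tupleMap_single_one, tupleAug, map_sum, map_zsmul, Finsupp.linearCombination_single,
    smul_eq_mul, monomial_mul, h]
  simp

theorem range_tupleAug :
    LinearMap.range (tupleAug k g) =
      Ideal.span (Set.range fun i => (monomial (g i) (1 : k))) := by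
  rw [tupleAug, Finsupp.range_linearCombination, Ideal.span]
  congr 1
  ext p
  constructor
  · rintro ⟨t, rfl⟩
    exact ⟨t 0, rfl⟩
  · rintro ⟨i, rfl⟩
    exact ⟨fun _ => i, rfl⟩

end Taylor
end ExtremalScarf

namespace ExtremalScarf

open MvPolynomial CategoryTheory Opposite

/-! ### The tuple complex as a projective resolution of the monomial ideal. -/

section Resolution

universe u
variable {σ ι : Type} (k : Type u) [Field k] (g : ι → σ →₀ ℕ)

/-- The Taylor complex on tuples as a simplicial module. -/
noncomputable def tupleSimplicial : SimplicialObject (ModuleCat.{u} (MvPolynomial σ k)) where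
  obj n := ModuleCat.of _ (TupleModule σ ι k (n.unop.len + 1))
  map f := ModuleCat.ofHom (tupleMap k g f.unop.toOrderHom)
  map_id n := by
    ext1
    exact tupleMap_id k g
  map_comp f f' := by
    ext1
    exact tupleMap_comp k g f.unop.toOrderHom f'.unop.toOrderHom

/-- The maps `tupleD` are the alternating face maps of a simplicial module, so the simplicial
identities give the vanishing. -/
theorem tupleD_comp_tupleD (n : ℕ) : tupleD k g (n + 1) ∘ₗ tupleD k g (n + 2) = 0 := by
  have h (m : ℕ) : AlgebraicTopology.AlternatingFaceMapComplex.objD (tupleSimplicial k g) m =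
      ModuleCat.ofHom (tupleD k g (m + 1)) := by
    ext1
    rw [AlgebraicTopology.AlternatingFaceMapComplex.objD, ModuleCat.hom_sum]
    rfl
  have := AlgebraicTopology.AlternatingFaceMapComplex.d_squared (tupleSimplicial k g) n
  rw [h, h] at this
  exact congrArg ModuleCat.Hom.hom this

/-- The Taylor complex on tuples. -/
noncomputable def tupleComplex : ChainComplex (ModuleCat.{u} (MvPolynomial σ k)) ℕ :=
  ChainComplex.of (fun n => ModuleCat.of _ (TupleModule σ ι k (n + 1)))
    (fun n => ModuleCat.ofHom (tupleD k g (n + 1)))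
    (fun n => ModuleCat.hom_ext (tupleD_comp_tupleD k g n))

theorem tupleComplex_d (n : ℕ) :
    (tupleComplex k g).d (n + 1) n = ModuleCat.ofHom (tupleD k g (n + 1)) :=
  ChainComplex.of_d (fun n => ModuleCat.of (MvPolynomial σ k) (TupleModule σ ι k (n + 1)))
    (fun n => ModuleCat.ofHom (tupleD k g (n + 1))) n

theorem tupleAug_mem (x : TupleModule σ ι k 1) :
    tupleAug k g x ∈ Ideal.span (Set.range fun i => (monomial (g i) (1 : k))) := by
  rw [← range_tupleAug]
  exact ⟨x, rfl⟩

/-- The augmentation of the Taylor complex onto the monomial ideal. -/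
noncomputable def tupleAugIdeal : (tupleComplex k g).X 0 ⟶ ModuleCat.of (MvPolynomial σ k)
    (Ideal.span (Set.range fun i => (monomial (g i) (1 : k)))) :=
  ModuleCat.ofHom ((tupleAug k g).codRestrict
    (Ideal.span (Set.range fun i => (monomial (g i) (1 : k)))) (tupleAug_mem k g))

theorem tupleComplex_d_comp_aug : (tupleComplex k g).d 1 0 ≫ tupleAugIdeal k g = 0 := by
  rw [tupleComplex_d]
  exact ModuleCat.hom_ext (LinearMap.ext fun x => Subtype.ext (tupleAug_tupleD k g x))

/-- The free resolution of a monomial ideal by tuples of generators. -/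
noncomputable def tupleResolution : ProjectiveResolution (ModuleCat.of (MvPolynomial σ k)
    (Ideal.span (Set.range fun i => (monomial (g i) (1 : k))))) where
  complex := tupleComplex k g
  projective n := by
    change Projective (ModuleCat.of (MvPolynomial σ k) (TupleModule σ ι k (n + 1)))
    rw [← IsProjective.iff_projective]
    infer_instance
  π := ((tupleComplex k g).toSingle₀Equiv _).symm
    ⟨tupleAugIdeal k g, tupleComplex_d_comp_aug k g⟩
  quasiIso := ⟨fun n => by
    cases n with
    | zero =>
      rw [ChainComplex.quasiIsoAt₀_iff, ShortComplex.quasiIso_iff_of_zeros']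
      · refine (ShortComplex.exact_and_epi_g_iff_of_iso (S₂ := ShortComplex.mk
          (ModuleCat.ofHom (tupleD k g 1)) (tupleAugIdeal k g)
          (by rw [← tupleComplex_d]; exact tupleComplex_d_comp_aug k g)) ?_).2 ⟨?_, ?_⟩
        · exact ShortComplex.isoMk (Iso.refl _) (Iso.refl _) (Iso.refl _)
            (by simp [← tupleComplex_d]; rfl) (by simp; rfl)
        · rw [ShortComplex.moduleCat_exact_iff]
          intro x hx
          refine exists_of_tupleD_eq_zero k g x ?_
          rw [tupleD_zero]
          have : tupleAug k g x = 0 := congrArg Subtype.val hx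
          rw [this, Finsupp.single_zero]
        · rw [ModuleCat.epi_iff_surjective]
          rintro ⟨y, hy⟩
          rw [← range_tupleAug] at hy
          obtain ⟨x, rfl⟩ := hy
          exact ⟨x, rfl⟩
      all_goals rfl
    | succ n =>
      rw [quasiIsoAt_iff_exactAt']
      · rw [HomologicalComplex.exactAt_iff' _ (n + 1 + 1) (n + 1) n (by simp) (by simp),
          ShortComplex.moduleCat_exact_iff]
        intro x hx
        obtain ⟨y, hy⟩ := exists_of_tupleD_eq_zero k g x
          ((congrArg (fun f => f.hom x) (tupleComplex_d k g n)).symm.trans hx)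
        exact ⟨y, (congrArg (fun f => f.hom y) (tupleComplex_d k g (n + 1))).trans hy⟩
      · apply ChainComplex.exactAt_succ_single_obj⟩

end Resolution
end ExtremalScarf

namespace ExtremalScarf

open MvPolynomial CategoryTheory

/-! ### Split classes in homology and finiteness over the base field. -/

section Homology

universe u

/-- The map `a` lifts to cycles and `b` descends to opcycles. Through homology their composite is
still the identity, so the map from `W` to homology is a split monomorphism. -/
theorem exists_mono_to_homology {C : Type*} [Category* C] [Abelian C] {ι : Type*}
    {c : ComplexShape ι} (K : HomologicalComplex C c) (i : ι) {W : C} (a : W ⟶ K.X i)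
    (b : K.X i ⟶ W) (ha : a ≫ K.d i (c.next i) = 0) (hb : K.d (c.prev i) i ≫ b = 0)
    (hab : a ≫ b = 𝟙 W) : ∃ α : W ⟶ K.homology i, Mono α := by
  refine ⟨K.liftCycles a _ rfl ha ≫ K.homologyπ i, ?_⟩
  have : (K.liftCycles a _ rfl ha ≫ K.homologyπ i) ≫
      K.homologyι i ≫ K.descOpcycles b _ rfl hb = 𝟙 W := by
    simp [hab]
  have h : Mono ((K.liftCycles a _ rfl ha ≫ K.homologyπ i) ≫
      K.homologyι i ≫ K.descOpcycles b _ rfl hb) := by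
    rw [this]; infer_instance
  exact mono_of_mono _ (K.homologyι i ≫ K.descOpcycles b _ rfl hb)

variable {k : Type u} [Field k] {S : Type u} [CommRing S] [Algebra k S]

theorem finite_of_epi {M N : ModuleCat.{u} S} (f : M ⟶ N) [Epi f]
    [Module.Finite k ((ModuleCat.restrictScalars (algebraMap k S)).obj M)] :
    Module.Finite k ((ModuleCat.restrictScalars (algebraMap k S)).obj N) :=
  Module.Finite.of_surjective ((ModuleCat.restrictScalars (algebraMap k S)).map f).hom
    ((ModuleCat.epi_iff_surjective _).1 inferInstance)

theorem finite_of_mono {M N : ModuleCat.{u} S} (f : M ⟶ N) [Mono f]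
    [Module.Finite k ((ModuleCat.restrictScalars (algebraMap k S)).obj N)] :
    Module.Finite k ((ModuleCat.restrictScalars (algebraMap k S)).obj M) :=
  Module.Finite.of_injective ((ModuleCat.restrictScalars (algebraMap k S)).map f).hom
    ((ModuleCat.mono_iff_injective _).1 inferInstance)

theorem finrank_le_of_mono {M N : ModuleCat.{u} S} (f : M ⟶ N) [Mono f]
    [Module.Finite k ((ModuleCat.restrictScalars (algebraMap k S)).obj N)] :
    Module.finrank k ((ModuleCat.restrictScalars (algebraMap k S)).obj M) ≤
      Module.finrank k ((ModuleCat.restrictScalars (algebraMap k S)).obj N) :=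
  LinearMap.finrank_le_finrank_of_injective
    (f := ((ModuleCat.restrictScalars (algebraMap k S)).map f).hom)
    ((ModuleCat.mono_iff_injective _).1 inferInstance)

theorem finite_homology {ι : Type*} {c : ComplexShape ι}
    (K : HomologicalComplex (ModuleCat.{u} S) c) (i : ι)
    [Module.Finite k ((ModuleCat.restrictScalars (algebraMap k S)).obj (K.X i))] :
    Module.Finite k ((ModuleCat.restrictScalars (algebraMap k S)).obj (K.homology i)) :=
  haveI := finite_of_mono (k := k) (K.iCycles i)
  finite_of_epi (K.homologyπ i)

end Homology

/-! ### Reduction modulo the variables and a lower bound for Betti numbers. -/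

section ResidueField

universe u
variable {σ : Type} (k : Type u) [Field k]

/-- The residue field of a polynomial ring at the origin, as a module over the ring. -/
noncomputable abbrev residueModule (σ : Type) (k : Type u) [Field k] :
    ModuleCat.{u} (MvPolynomial σ k) :=
  ModuleCat.of (MvPolynomial σ k)
    (MvPolynomial σ k ⧸ Ideal.span (Set.range (X (R := k) (σ := σ))))

theorem monomial_mem_span_range_X {u : σ →₀ ℕ} (hu : u ≠ 0) (r : k) :
    monomial u r ∈ Ideal.span (Set.range (X (R := k) (σ := σ))) := by
  rw [← Set.image_univ, mem_ideal_span_X_image]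
  intro m hm
  obtain ⟨i, hi⟩ := Finsupp.ne_iff.1 hu
  have : m = u := Finset.mem_singleton.1 (support_monomial_subset hm)
  exact ⟨i, trivial, this ▸ hi⟩

theorem sub_C_constantCoeff_mem (p : MvPolynomial σ k) :
    p - C (constantCoeff p) ∈ Ideal.span (Set.range (X (R := k) (σ := σ))) := by
  rw [← Set.image_univ, mem_ideal_span_X_image]
  intro m hm
  have hm0 : m ≠ 0 := by
    rintro rfl
    rw [mem_support_iff] at hm
    exact hm (by simp [constantCoeff_eq])
  obtain ⟨i, hi⟩ := Finsupp.ne_iff.1 hm0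
  exact ⟨i, trivial, hi⟩

theorem span_range_X_le_ker :
    Ideal.span (Set.range (X (R := k) (σ := σ))) ≤ RingHom.ker constantCoeff := by
  rw [Ideal.span_le]
  rintro _ ⟨i, rfl⟩
  exact constantCoeff_X k i

/-- The residue field of a polynomial ring at the origin is the field of coefficients. -/
noncomputable def residueEquiv :
    (MvPolynomial σ k ⧸ Ideal.span (Set.range (X (R := k) (σ := σ)))) ≃+ k where
  toFun := Ideal.Quotient.lift _ (constantCoeff (R := k) (σ := σ)) fun _ hp =>
    RingHom.mem_ker.1 (span_range_X_le_ker k hp)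
  invFun c := Ideal.Quotient.mk _ (C c)
  left_inv x := by
    obtain ⟨p, rfl⟩ := Ideal.Quotient.mk_surjective x
    refine Eq.symm (Ideal.Quotient.eq.2 ?_)
    exact sub_C_constantCoeff_mem k p
  right_inv c := constantCoeff_C σ c
  map_add' := map_add _

theorem residueEquiv_smul (c : k)
    (x : MvPolynomial σ k ⧸ Ideal.span (Set.range (X (R := k) (σ := σ)))) :
    residueEquiv k ((C c : MvPolynomial σ k) • x) = c * residueEquiv k x := by
  obtain ⟨p, rfl⟩ := Ideal.Quotient.mk_surjective x
  change constantCoeff (C c * p) = c * constantCoeff p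
  simp

/-- The reduction of a free module at the origin is a vector space with the same basis. -/
noncomputable def residueTensorEquiv (J : Type) [DecidableEq J] :
    (ModuleCat.restrictScalars (algebraMap k (MvPolynomial σ k))).obj
      (((MonoidalCategory.tensoringLeft (ModuleCat.{u} (MvPolynomial σ k))).obj
        (residueModule σ k)).obj (ModuleCat.of _ (J →₀ MvPolynomial σ k))) ≃ₗ[k] (J →₀ k) where
  __ := (TensorProduct.finsuppScalarRight (MvPolynomial σ k) (MvPolynomial σ k)
    (MvPolynomial σ k ⧸ Ideal.span (Set.range (X (R := k) (σ := σ)))) J).toAddEquiv.trans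
    (Finsupp.mapRange.addEquiv (residueEquiv k))
  map_smul' c x := by
    ext j
    have := DFunLike.congr_fun ((TensorProduct.finsuppScalarRight (MvPolynomial σ k)
      (MvPolynomial σ k)
      (MvPolynomial σ k ⧸ Ideal.span (Set.range (X (R := k) (σ := σ)))) J).map_smul (C c) x) j
    exact (congrArg (residueEquiv k) this).trans (residueEquiv_smul k c _)

theorem tensor_map_eq_zero {J J' : Type} (f : (J →₀ MvPolynomial σ k) →ₗ[MvPolynomial σ k]
      (J' →₀ MvPolynomial σ k))
    (hf : ∀ j j', f (Finsupp.single j 1) j' ∈ Ideal.span (Set.range (X (R := k) (σ := σ)))) :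
    ((MonoidalCategory.tensoringLeft (ModuleCat.{u} (MvPolynomial σ k))).obj
        (residueModule σ k)).map (ModuleCat.ofHom f) = 0 := by
  have h : f.lTensor (MvPolynomial σ k ⧸ Ideal.span (Set.range (X (R := k) (σ := σ)))) = 0 := by
    refine TensorProduct.ext' fun x y => ?_
    rw [LinearMap.lTensor_tmul, LinearMap.zero_apply]
    induction y using Finsupp.induction_linear with
    | zero => simp
    | add y z hy hz => rw [map_add, TensorProduct.tmul_add, hy, hz, add_zero]
    | single j p =>
      rw [← mul_one p, ← smul_eq_mul, ← Finsupp.smul_single, map_smul, TensorProduct.tmul_smul,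
        ← Finsupp.sum_single (f (Finsupp.single j 1)), Finsupp.sum, TensorProduct.tmul_sum,
        Finset.sum_eq_zero, smul_zero]
      intro j' _
      have h0 : f (Finsupp.single j 1) j' • x = 0 := by
        obtain ⟨q, rfl⟩ := Ideal.Quotient.mk_surjective x
        rw [← Ideal.Quotient.mk_eq_mk, ← Submodule.Quotient.mk_smul, Ideal.Quotient.mk_eq_mk,
          Ideal.Quotient.eq_zero_iff_mem]
        exact Ideal.mul_mem_right _ _ (hf j j')
      rw [← mul_one (f (Finsupp.single j 1) j'), ← smul_eq_mul, ← Finsupp.smul_single,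
        TensorProduct.tmul_smul]
      exact (TensorProduct.smul_tmul' _ _ _).trans (by rw [h0, TensorProduct.zero_tmul])
  exact ModuleCat.hom_ext h

variable {ι : Type} [Finite ι] (g : ι → σ →₀ ℕ)

/-- After tensoring with the residue field, maps with entries in the ideal of the variables vanish.
Thus `a` and `b` satisfy the hypotheses of `exists_mono_to_homology`, and a space of dimension `|J|`
embeds in Tor. -/
theorem card_le_betti {J : Type} [Fintype J] (i : ℕ)
    (a : (J →₀ MvPolynomial σ k) →ₗ[MvPolynomial σ k] TupleModule σ ι k (i + 1))
    (b : TupleModule σ ι k (i + 1) →ₗ[MvPolynomial σ k] (J →₀ MvPolynomial σ k))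
    (ha : i ≠ 0 → ∀ j t, tupleD k g i (a (Finsupp.single j 1)) t ∈
      Ideal.span (Set.range (X (R := k) (σ := σ))))
    (hb : ∀ t j, b (tupleD k g (i + 1) (Finsupp.single t 1)) j ∈
      Ideal.span (Set.range (X (R := k) (σ := σ))))
    (hab : b ∘ₗ a = LinearMap.id) :
    Fintype.card J ≤ betti i (Ideal.span (Set.range fun i => (monomial (g i) (1 : k)))) := by
  classical
  let F := (MonoidalCategory.tensoringLeft (ModuleCat.{u} (MvPolynomial σ k))).obj
    (residueModule σ k)
  let K := (F.mapHomologicalComplex (ComplexShape.down ℕ)).obj (tupleComplex k g)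
  have hfin : Module.Finite k
      ((ModuleCat.restrictScalars (algebraMap k (MvPolynomial σ k))).obj (K.X i)) :=
    Module.Finite.equiv (residueTensorEquiv k (σ := σ) (Fin (i + 1) → ι)).symm
  obtain ⟨α, hα⟩ := exists_mono_to_homology K i (W := F.obj (ModuleCat.of _ _))
    (F.map (ModuleCat.ofHom a)) (F.map (ModuleCat.ofHom b))
    (by
      cases i with
      -- In degree zero the outgoing differential is zero; `tupleD k g 0` is the augmentation and
      -- not part of the complex, whence the condition `i ≠ 0` in `ha`.
      | zero => exact (congrArg _ (K.shape _ _ (by simp))).trans Limits.comp_zero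
      | succ n =>
        rw [show (ComplexShape.down ℕ).next (n + 1) = n by simp]
        change F.map (ModuleCat.ofHom a) ≫ F.map ((tupleComplex k g).d (n + 1) n) = 0
        rw [tupleComplex_d]
        refine (F.map_comp _ _).symm.trans
          (tensor_map_eq_zero k (tupleD k g (n + 1) ∘ₗ a) (ha n.succ_ne_zero)))
    (by
      rw [show (ComplexShape.down ℕ).prev i = i + 1 by simp]
      change F.map ((tupleComplex k g).d (i + 1) i) ≫ F.map (ModuleCat.ofHom b) = 0
      rw [tupleComplex_d]
      exact (F.map_comp _ _).symm.trans (tensor_map_eq_zero k (b ∘ₗ tupleD k g (i + 1)) hb))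
    (by
      refine (F.map_comp _ _).symm.trans ?_
      rw [← F.map_id]
      congr 1
      exact ModuleCat.hom_ext hab)
  have := finite_homology (k := k) K i
  have e := (tupleResolution k g).isoLeftDerivedObj F i
  calc Fintype.card J = Module.finrank k (J →₀ k) := by simp
    _ = _ := (LinearEquiv.finrank_eq (residueTensorEquiv k (σ := σ) J)).symm
    _ ≤ _ := finrank_le_of_mono α
    _ = _ := (LinearEquiv.finrank_eq ((ModuleCat.restrictScalars (algebraMap k
      (MvPolynomial σ k))).mapIso e).toLinearEquiv).symm

end ResidueField
end ExtremalScarf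

namespace ExtremalScarf

open MvPolynomial

/-! ### Alternating functionals on tuples. -/

section IncidenceDet

variable {ι : Type*} (R : Type*) [CommRing R]

open Classical in
/-- The sign of the permutation relating two enumerations of a set, and zero for tuples that are
not enumerations of the same set. -/
noncomputable def incidenceDet {n : ℕ} (e t : Fin n → ι) : R :=
  (Matrix.of fun i j => if t i = e j then (1 : R) else 0).det

theorem incidenceDet_self {n : ℕ} {e : Fin n → ι} (he : e.Injective) :
    incidenceDet R e e = 1 := by
  rw [incidenceDet, ← Matrix.det_one (n := Fin n)]
  congr 1
  ext i j
  simp [Matrix.one_apply, he.eq_iff]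

theorem range_eq_of_incidenceDet_ne_zero {n : ℕ} {e t : Fin n → ι}
    (h : incidenceDet R e t ≠ 0) : Set.range t = Set.range e := by
  apply Set.Subset.antisymm
  · rintro _ ⟨i, rfl⟩
    by_contra hi
    refine h (Matrix.det_eq_zero_of_row_eq_zero i fun j => if_neg fun hj => hi ⟨j, hj.symm⟩)
  · rintro _ ⟨j, rfl⟩
    by_contra hj
    refine h (Matrix.det_eq_zero_of_column_eq_zero j fun i => if_neg fun hi => hj ⟨i, hi⟩)

/-- The sum is the expansion along the first column of the incidence matrix bordered by a column of
ones. Each `t i` equals exactly one `e j`, so that column is the sum of the others and the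
determinant vanishes. -/
theorem sum_incidenceDet_eq_zero {n : ℕ} {e : Fin n → ι} (he : e.Injective) (t : Fin (n + 1) → ι)
    (ht : Set.range t ⊆ Set.range e) :
    ∑ j : Fin (n + 1), (-1) ^ (j : ℕ) * incidenceDet R e (t ∘ j.succAbove) = 0 := by
  classical
  let A : Matrix (Fin (n + 1)) (Fin (n + 1)) R := Matrix.of fun i =>
    Fin.cons 1 fun j => if t i = e j then (1 : R) else 0
  have h1 : A.det = ∑ j : Fin (n + 1), (-1) ^ (j : ℕ) * incidenceDet R e (t ∘ j.succAbove) := by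
    rw [Matrix.det_succ_column_zero]
    refine Finset.sum_congr rfl fun j _ => ?_
    rw [show A j 0 = 1 from rfl, mul_one, incidenceDet]
    rfl
  have h2 : A.updateCol 0 (fun i => ∑ j, (Fin.cons 0 1 : Fin (n + 1) → R) j • A i j) = A := by
    convert Matrix.updateCol_eq_self A 0 with i
    obtain ⟨j, hj⟩ := ht ⟨i, rfl⟩
    rw [Fin.sum_univ_succ]
    simp [A, ← hj, he.eq_iff]
  have h3 := Matrix.det_updateCol_sum A 0 (Fin.cons 0 1)
  rw [h2] at h3
  rw [← h1, h3, Fin.cons_zero, zero_smul]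

end IncidenceDet

/-! ### Scarf faces are bounded by Betti numbers, for any monomial ideal with finitely many
generators. -/

section ScarfTuple

universe u
variable {σ ι J : Type} (k : Type u) [Field k] (g : ι → σ →₀ ℕ)

/-- An enumeration of a face of the Scarf complex: a tuple of distinct generators such that every
tuple with the same least common multiple has the same entries. -/
def IsScarfTuple {n : ℕ} (e : Fin n → ι) : Prop :=
  e.Injective ∧ ∀ {m : ℕ} (t : Fin (m + 1) → ι), tupleLabel g t = tupleLabel g e →
    Set.range t = Set.range e

theorem tupleLabel_eq_of_range_eq {m n : ℕ} {t : Fin m → ι} {e : Fin n → ι}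
    (h : Set.range t = Set.range e) : tupleLabel g t = tupleLabel g e := by
  apply le_antisymm <;> rw [tupleLabel_le_iff] <;> intro i
  · obtain ⟨j, hj⟩ : t i ∈ Set.range e := h ▸ ⟨i, rfl⟩
    exact hj ▸ le_tupleLabel g e j
  · obtain ⟨j, hj⟩ : e i ∈ Set.range t := h ▸ ⟨i, rfl⟩
    exact hj ▸ le_tupleLabel g t j

/-- The map sending each basis vector to the tuple that enumerates a face. -/
noncomputable def scarfInclusion {n : ℕ} (e : J → Fin n → ι) :
    (J →₀ MvPolynomial σ k) →ₗ[MvPolynomial σ k] TupleModule σ ι k n :=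
  Finsupp.linearCombination _ fun j => Finsupp.single (e j) 1

/-- The map reading off the alternating coefficients of the given faces. -/
noncomputable def scarfProjection [Finite J] {n : ℕ} (e : J → Fin n → ι) :
    TupleModule σ ι k n →ₗ[MvPolynomial σ k] (J →₀ MvPolynomial σ k) :=
  Finsupp.linearCombination _ fun t =>
    Finsupp.equivFunOnFinite.symm fun j => incidenceDet _ (e j) t

theorem scarfProjection_single [Finite J] {n : ℕ} (e : J → Fin n → ι) (t : Fin n → ι)
    (p : MvPolynomial σ k) (j : J) :
    scarfProjection k e (Finsupp.single t p) j = p * incidenceDet _ (e j) t := by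
  simp [scarfProjection]

theorem scarfProjection_comp_inclusion [Finite J] {n : ℕ} {e : J → Fin n → ι}
    (he : ∀ j, (e j).Injective) (hd : ∀ j j', Set.range (e j) = Set.range (e j') → j = j') :
    scarfProjection (σ := σ) k e ∘ₗ scarfInclusion k e = LinearMap.id := by
  classical
  refine Finsupp.lhom_ext' fun j => LinearMap.ext_ring (Finsupp.ext fun j' => ?_)
  simp only [LinearMap.coe_comp, Function.comp_apply, Finsupp.lsingle_apply, scarfInclusion,
    Finsupp.linearCombination_single, one_smul, scarfProjection_single, one_mul,
    LinearMap.id_apply]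
  rcases eq_or_ne j j' with rfl | hj
  · rw [incidenceDet_self _ (he j), Finsupp.single_eq_same]
  · rw [Finsupp.single_eq_of_ne hj.symm]
    by_contra h
    exact hj (hd _ _ (range_eq_of_incidenceDet_ne_zero _ h))

/-- Deleting an entry of a Scarf tuple must change the label: otherwise the shorter tuple would have
the same entries, against injectivity. So every coefficient is a nonconstant monomial. -/
theorem tupleD_scarf_mem {n : ℕ} {e : Fin (n + 2) → ι} (he : IsScarfTuple g e)
    (t : Fin (n + 1) → ι) : tupleD k g (n + 1) (Finsupp.single e 1) t ∈
      Ideal.span (Set.range (X (R := k) (σ := σ))) := by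
  classical
  rw [tupleD_apply, Finsupp.finsetSum_apply]
  refine Ideal.sum_mem _ fun i _ => ?_
  rw [Finsupp.smul_apply]
  refine zsmul_mem ?_ _
  rw [tupleMap_single_one, Finsupp.single_apply]
  split_ifs
  · refine monomial_mem_span_range_X k (fun h => ?_) _
    have h1 := he.2 (e ∘ i.succAbove)
      (le_antisymm (tupleLabel_comp_le g _ _) (tsub_eq_zero_iff_le.1 h))
    obtain ⟨j, hj⟩ : e i ∈ Set.range (e ∘ i.succAbove) := h1 ▸ ⟨i, rfl⟩
    exact i.succAbove_ne j (he.1 hj)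
  · exact Ideal.zero_mem _

/-- Only faces of `t` that enumerate the `j`-th set contribute. If `t` has the label of that set,
their coefficients are signs, `t` has its entries in the set by the Scarf property, and
`sum_incidenceDet_eq_zero` applies. Otherwise the label drops on passing to such a face, and the
coefficient is a nonconstant monomial. -/
theorem scarfProjection_tupleD_mem [Finite J] {n : ℕ} {e : J → Fin n → ι}
    (he : ∀ j, IsScarfTuple g (e j)) (t : Fin (n + 1) → ι) (j : J) :
    scarfProjection k e (tupleD k g n (Finsupp.single t 1)) j ∈
      Ideal.span (Set.range (X (R := k) (σ := σ))) := by
  simp only [tupleD_apply, map_sum, map_zsmul, tupleMap_single_one, Finsupp.finsetSum_apply,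
    Finsupp.smul_apply, scarfProjection_single]
  by_cases ht : tupleLabel g t = tupleLabel g (e j)
  · convert Ideal.zero_mem _
    rw [← sum_incidenceDet_eq_zero (MvPolynomial σ k) (he j).1 t ((he j).2 t ht).le]
    refine Finset.sum_congr rfl fun i _ => ?_
    by_cases h : incidenceDet (MvPolynomial σ k) (e j) (t ∘ i.succAbove) = 0
    · simp [h]
    · rw [tupleLabel_eq_of_range_eq g (range_eq_of_incidenceDet_ne_zero _ h), ht, tsub_self]
      simp
  · refine Ideal.sum_mem _ fun i _ => zsmul_mem ?_ _
    by_cases h : incidenceDet (MvPolynomial σ k) (e j) (t ∘ i.succAbove) = 0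
    · simp [h]
    · refine Ideal.mul_mem_right _ _ (monomial_mem_span_range_X k (fun h0 => ht ?_) _)
      rw [← tupleLabel_eq_of_range_eq g (range_eq_of_incidenceDet_ne_zero _ h)]
      exact le_antisymm (tsub_eq_zero_iff_le.1 h0) (tupleLabel_comp_le g _ _)

theorem card_scarfTuple_le_betti [Finite ι] [Fintype J] (i : ℕ) {e : J → Fin (i + 1) → ι}
    (he : ∀ j, IsScarfTuple g (e j)) (hd : ∀ j j', Set.range (e j) = Set.range (e j') → j = j') :
    Fintype.card J ≤ betti i (Ideal.span (Set.range fun i => (monomial (g i) (1 : k)))) := by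
  refine card_le_betti k g i (scarfInclusion k e) (scarfProjection k e) (fun hi j t => ?_)
    (scarfProjection_tupleD_mem k g he) (scarfProjection_comp_inclusion k (fun j => (he j).1) hd)
  obtain ⟨n, rfl⟩ := Nat.exists_eq_succ_of_ne_zero hi
  rw [scarfInclusion, Finsupp.linearCombination_single, one_smul]
  exact tupleD_scarf_mem k g (he j) t

theorem fNumber_scarfComplex_le_betti (I : Ideal (MvPolynomial σ k)) (G : Finset (σ →₀ ℕ))
    (hG : (G : Set (σ →₀ ℕ)) = minGens I)
    (hI : I = Ideal.span ((fun m => monomial m (1 : k)) '' G)) (i : ℕ) :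
    fNumber (scarfComplex I) i ≤ betti i I := by
  classical
  have hsub {s : Finset (σ →₀ ℕ)} (hs : s ∈ (scarfComplex I).faces) : s ⊆ G := by
    rw [← Finset.coe_subset, hG]
    exact hs.1.2
  have hfin : {s | s ∈ (scarfComplex I).faces ∧ s.card = i + 1}.Finite :=
    G.powerset.finite_toSet.subset fun s hs => Finset.mem_powerset.2 (hsub hs.1)
  have := hfin.fintype
  have hex (s : {s | s ∈ (scarfComplex I).faces ∧ s.card = i + 1}) :
      ∃ e : Fin (i + 1) → {m // m ∈ G}, e.Injective ∧ ∀ m, m ∈ s.1 ↔ ∃ j, (e j).1 = m := by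
    let f := (s.1.equivFinOfCardEq s.2.2).symm
    refine ⟨fun j => ⟨f j, hsub s.2.1 (f j).2⟩, fun a b h => ?_, fun m => ⟨fun hm => ?_, ?_⟩⟩
    · exact f.injective (Subtype.ext (congrArg (fun x : {m // m ∈ G} => x.1) h))
    · exact ⟨f.symm ⟨m, hm⟩, by simp⟩
    · rintro ⟨j, rfl⟩
      exact (f j).2
  choose e he hmem using hex
  have hlabel {n : ℕ} (t : Fin n → {m // m ∈ G}) (s : Finset (σ →₀ ℕ))
      (hs : ∀ m, m ∈ s ↔ ∃ j, (t j).1 = m) : tupleLabel Subtype.val t = label s := by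
    have : s = Finset.univ.image fun j => (t j).1 := by ext m; simp [hs]
    rw [this, label, Finset.sup_image, tupleLabel]
    rfl
  have hscarf s : IsScarfTuple (Subtype.val : {m // m ∈ G} → σ →₀ ℕ) (e s) := by
    refine ⟨he s, fun t ht => ?_⟩
    have h1 : Finset.univ.image (fun j => (t j).1) = s.1 := by
      refine s.2.1.2 _ ⟨⟨(t 0).1, by simp⟩, ?_⟩ ?_
      · rw [← hG]
        intro m hm
        obtain ⟨j, -, rfl⟩ := Finset.mem_image.1 hm
        exact (t j).2
      · rw [← hlabel t _ (by simp), ht, hlabel _ _ (hmem s)]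
    ext x
    have h2 := Finset.ext_iff.1 h1 x.1
    rw [hmem] at h2
    simpa only [Finset.mem_image, Finset.mem_univ, true_and, Set.mem_range, ← Subtype.ext_iff]
      using h2
  have hd s s' (h : Set.range (e s) = Set.range (e s')) : s = s' := by
    refine Subtype.ext (Finset.ext fun m => ?_)
    rw [hmem, hmem]
    constructor <;> rintro ⟨j, rfl⟩
    · obtain ⟨j', hj'⟩ : e s j ∈ Set.range (e s') := h ▸ ⟨j, rfl⟩
      exact ⟨j', by rw [hj']⟩
    · obtain ⟨j', hj'⟩ : e s' j ∈ Set.range (e s) := h ▸ ⟨j, rfl⟩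
      exact ⟨j', by rw [hj']⟩
  have key := card_scarfTuple_le_betti k _ i hscarf hd
  have hI' : Ideal.span (Set.range fun m : {m // m ∈ G} => monomial m.1 (1 : k)) = I := by
    rw [hI, Set.image_eq_range]
    rfl
  rw [hI'] at key
  rw [fNumber, ← Set.coe_fintypeCard]
  exact_mod_cast key

end ScarfTuple
end ExtremalScarf

namespace ExtremalScarf

open MvPolynomial

/-! ### Generators of powers of the extremal ideal, and the faces of `𝕌_q^r`. -/

section Combinatorics

variable {q : ℕ}

theorem epsExp_apply (a : Fin q → ℕ) (A : Var q) : epsExp a A = ∑ i ∈ A.1, a i := by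
  simp only [epsExp, Finsupp.finsetSum_apply, Finsupp.smul_apply, Finsupp.single_apply,
    Finset.sum_ite_eq', Finset.mem_filter, Finset.mem_univ, true_and, smul_eq_mul, mul_ite,
    mul_one, mul_zero]
  rw [← Finset.sum_filter, Finset.filter_mem_eq_inter, Finset.univ_inter]

theorem epsExp_add (a b : Fin q → ℕ) : epsExp (a + b) = epsExp a + epsExp b := by
  ext A
  simp [epsExp_apply, Finset.sum_add_distrib]

theorem le_of_epsExp_le {a b : Fin q → ℕ} (h : epsExp a ≤ epsExp b) : a ≤ b := fun i => by
  simpa [epsExp_apply] using h ⟨{i}, Finset.singleton_nonempty i⟩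

theorem epsExp_injective : Function.Injective (epsExp (q := q)) := fun _ _ h =>
  le_antisymm (le_of_epsExp_le h.le) (le_of_epsExp_le h.ge)

theorem extremalIdeal_pow (k : Type*) [CommSemiring k] (q r : ℕ) :
    extremalIdeal k q ^ r = Ideal.span ((fun m => monomial m (1 : k)) ''
      (epsExp '' {a : Fin q → ℕ | ∑ i, a i = r})) := by
  have hε (i : Fin q) : epsilon k q i = monomial (epsExp (Pi.single i 1)) (1 : k) := by
    rw [← prod_epsilon_pow, Finset.prod_eq_single i]
    · simp
    · intro j _ hj
      simp [hj]
    · simp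
  induction r with
  | zero =>
    rw [pow_zero, Ideal.one_eq_top, eq_comm, Ideal.eq_top_iff_one]
    refine Ideal.subset_span ⟨_, ⟨0, by simp, rfl⟩, ?_⟩
    have : epsExp (0 : Fin q → ℕ) = 0 := by ext A; simp [epsExp_apply]
    simp [this]
  | succ r ih =>
    rw [pow_succ, ih, extremalIdeal, Ideal.span_mul_span]
    congr 1
    ext p
    constructor
    · rintro ⟨_, ⟨_, ⟨a, ha, rfl⟩, rfl⟩, _, ⟨i, rfl⟩, rfl⟩
      refine ⟨_, ⟨a + Pi.single i 1, ?_, rfl⟩, ?_⟩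
      · have ha' : ∑ i, a i = r := ha
        simp [Finset.sum_add_distrib, ha']
      · simp [hε, monomial_mul, epsExp_add]
    · rintro ⟨_, ⟨b, hb, rfl⟩, rfl⟩
      have hb' : ∑ i, b i = r + 1 := hb
      obtain ⟨i, -, hi⟩ : ∃ i ∈ Finset.univ, b i ≠ 0 :=
        Finset.exists_ne_zero_of_sum_ne_zero (by omega)
      have hsub : b - Pi.single i 1 + Pi.single i 1 = b := by
        ext j
        rcases eq_or_ne j i with rfl | hj
        · simp; omega
        · simp [hj]
      refine ⟨_, ⟨_, ⟨b - Pi.single i 1, ?_, rfl⟩, rfl⟩, _, ⟨i, rfl⟩, ?_⟩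
      · have := congrArg (fun c : Fin q → ℕ => ∑ i, c i) hsub
        simp only [Pi.add_apply, Finset.sum_add_distrib, Finset.sum_pi_single', Finset.mem_univ,
          if_true, hb'] at this
        exact Nat.succ_injective this
      · simp [hε, monomial_mul, ← epsExp_add, hsub]

/-- Divisibility of `ε^a` by `ε^b` forces `b ≤ a` through the singleton variables, hence equality
when the totals agree. So no product of `r` of the `ε_i` is redundant. -/
theorem minGens_extremalIdeal_pow (k : Type*) [Field k] (q r : ℕ) :
    minGens (extremalIdeal k q ^ r) = epsExp '' {a : Fin q → ℕ | ∑ i, a i = r} := by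
  have hmem (m : Var q →₀ ℕ) : monomial m (1 : k) ∈ extremalIdeal k q ^ r ↔
      ∃ a : Fin q → ℕ, ∑ i, a i = r ∧ epsExp a ≤ m := by
    classical
    rw [extremalIdeal_pow, mem_ideal_span_monomial_image]
    simp [support_monomial]
  have huniq {a b : Fin q → ℕ} (ha : ∑ i, a i = r) (hb : ∑ i, b i = r)
      (h : epsExp a ≤ epsExp b) : a = b := by
    have h1 := le_of_epsExp_le h
    exact funext fun i => (Finset.sum_eq_sum_iff_of_le fun i _ => h1 i).1 (ha.trans hb.symm) i
      (Finset.mem_univ i)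
  ext m
  simp only [minGens, Set.mem_ofPred_eq, hmem]
  constructor
  · rintro ⟨⟨a, ha, ham⟩, hmin⟩
    exact ⟨a, ha, le_antisymm ham (hmin ⟨a, ha, le_rfl⟩ ham)⟩
  · rintro ⟨a, ha, rfl⟩
    refine ⟨⟨a, ha, le_rfl⟩, ?_⟩
    rintro m ⟨b, hb, hbm⟩ hma
    rwa [← huniq hb ha (hbm.trans hma)]

theorem coe_minGens_finset (k : Type*) [Field k] (q r : ℕ) :
    (((Finset.piAntidiag Finset.univ r).image epsExp : Finset (Var q →₀ ℕ)) : Set _) =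
      minGens (extremalIdeal k q ^ r) := by
  rw [minGens_extremalIdeal_pow]
  ext m
  simp

theorem mem_shiftedFace {r : ℕ} {a : Fin q → ℕ} (har : ∑ i, a i ≤ r) {m : Var q →₀ ℕ} :
    m ∈ shiftedFace r a ↔
      ∃ b : Fin q → ℕ, epsExp b = m ∧ ∑ i, b i = r ∧ ∀ i, a i ≤ b i ∧ b i ≤ a i + 1 := by
  simp only [shiftedFace, squareFreeFace, Finset.mem_image, Finset.mem_filter,
    Finset.mem_piAntidiag, Finset.mem_univ]
  constructor
  · rintro ⟨_, ⟨c, ⟨⟨hc, -⟩, hc1⟩, rfl⟩, rfl⟩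
    refine ⟨a + c, epsExp_add a c, ?_, fun i => ⟨by simp, by simpa using hc1 i⟩⟩
    have hc' : ∑ i, c i = r - ∑ i, a i := hc
    simp only [Pi.add_apply, Finset.sum_add_distrib]
    omega
  · rintro ⟨b, rfl, hb, hab⟩
    have h : a + (b - a) = b := funext fun i => Nat.add_sub_of_le (hab i).1
    refine ⟨epsExp (b - a), ⟨b - a, ⟨⟨?_, by simp⟩, fun i => ?_⟩, rfl⟩, ?_⟩
    · have := congrArg (fun c : Fin q → ℕ => ∑ i, c i) h
      simp only [Pi.add_apply, Finset.sum_add_distrib] at this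
      change ∑ i, (b - a) i = _
      omega
    · have := hab i
      simp only [Pi.sub_apply]
      omega
    · rw [← epsExp_add, h]

theorem label_apply_le_iff {σ : Type*} (s : Finset (σ →₀ ℕ)) (x : σ) (n : ℕ) :
    label s x ≤ n ↔ ∀ m ∈ s, m x ≤ n := by
  classical
  induction s using Finset.induction_on with
  | empty => simp [label, bot_eq_zero]
  | insert m s _ ih =>
    rw [label] at ih
    simp [label, ih]

theorem apply_le_label {σ : Type*} {s : Finset (σ →₀ ℕ)} {m : σ →₀ ℕ} (hm : m ∈ s) (x : σ) :
    m x ≤ label s x :=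
  (label_apply_le_iff s x _).1 le_rfl m hm

theorem sum_add_indicator (a : Fin q → ℕ) (A C : Finset (Fin q)) :
    ∑ i ∈ A, (a i + if i ∈ C then 1 else 0) = ∑ i ∈ A, a i + (A ∩ C).card := by
  rw [Finset.sum_add_distrib, Finset.sum_ite_mem, Finset.card_eq_sum_ones]

theorem add_indicator_mem_shiftedFace {r : ℕ} {a : Fin q → ℕ} (har : ∑ i, a i ≤ r)
    {C : Finset (Fin q)} (hC : ∑ i, a i + C.card = r) :
    epsExp (fun i => a i + if i ∈ C then 1 else 0) ∈ shiftedFace r a := by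
  refine (mem_shiftedFace har).2 ⟨_, rfl, ?_, fun i => ⟨by simp, by split_ifs <;> simp⟩⟩
  rw [sum_add_indicator, Finset.univ_inter, hC]

theorem exists_eq_add_indicator {r : ℕ} {a : Fin q → ℕ} (har : ∑ i, a i ≤ r) {m : Var q →₀ ℕ}
    (hm : m ∈ shiftedFace r a) : ∃ C : Finset (Fin q), ∑ i, a i + C.card = r ∧
      m = epsExp (fun i => a i + if i ∈ C then 1 else 0) := by
  obtain ⟨b, rfl, hb, hab⟩ := (mem_shiftedFace har).1 hm
  have h : b = fun i => a i + if i ∈ ({i | a i < b i} : Finset (Fin q)) then 1 else 0 := by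
    ext i
    have := hab i
    simp only [Finset.mem_filter, Finset.mem_univ, true_and]
    split_ifs <;> omega
  refine ⟨_, ?_, congrArg _ h⟩
  rw [h, sum_add_indicator] at hb
  simpa only [Finset.univ_inter] using hb

theorem label_shiftedFace_le {r : ℕ} {a : Fin q → ℕ} (har : ∑ i, a i ≤ r) (A : Var q) :
    label (shiftedFace r a) A ≤ ∑ i ∈ A.1, a i + min A.1.card (r - ∑ i, a i) := by
  rw [label_apply_le_iff]
  intro m hm
  obtain ⟨C, hC, rfl⟩ := exists_eq_add_indicator har hm
  rw [epsExp_apply, sum_add_indicator]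
  have h1 : (A.1 ∩ C).card ≤ A.1.card := Finset.card_le_card Finset.inter_subset_left
  have h2 : (A.1 ∩ C).card ≤ C.card := Finset.card_le_card Finset.inter_subset_right
  omega

theorem mem_shiftedFace_of_le_label {r : ℕ} {a b : Fin q → ℕ} (hrq : r < ∑ i, a i + q)
    (har : ∑ i, a i < r) (hb : ∑ i, b i = r)
    (h : epsExp b ≤ label (shiftedFace r a)) : epsExp b ∈ shiftedFace r a := by
  refine (mem_shiftedFace har.le).2 ⟨b, rfl, hb, fun i => ⟨?_, ?_⟩⟩
  -- At the complement of `i` the label exceeds the partial sum of `a` by at most `r - |a|`, so `r -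
  -- b i ≤ r - a i`. The two bounds on `|a|` force `q ≥ 2`, which makes this complement nonempty.
  · have hne : ({i}ᶜ : Finset (Fin q)).Nonempty := by
      rw [← Finset.card_pos, Finset.card_compl]
      simp
      omega
    have h1 := (h ⟨_, hne⟩).trans (label_shiftedFace_le har.le ⟨_, hne⟩)
    rw [epsExp_apply] at h1
    have h2 := Finset.sum_add_sum_compl {i} a
    have h3 := Finset.sum_add_sum_compl {i} b
    simp only [Finset.sum_singleton] at h1 h2 h3
    omega
  · have h1 := (h ⟨{i}, Finset.singleton_nonempty i⟩).trans
      (label_shiftedFace_le har.le ⟨{i}, Finset.singleton_nonempty i⟩)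
    rw [epsExp_apply] at h1
    simp only [Finset.sum_singleton, Finset.card_singleton] at h1
    omega

theorem shiftedFace_nonempty {r : ℕ} {a : Fin q → ℕ} (hrq : r < ∑ i, a i + q)
    (har : ∑ i, a i < r) : (shiftedFace r a).Nonempty := by
  obtain ⟨C, -, hC⟩ := Finset.exists_subset_card_eq (s := (Finset.univ : Finset (Fin q)))
    (n := r - ∑ i, a i) (by simp; omega)
  exact ⟨_, add_indicator_mem_shiftedFace har.le (C := C) (by omega)⟩

theorem shiftedFace_mem_scarfComplex (k : Type*) [Field k] {r : ℕ} {a : Fin q → ℕ}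
    (hrq : r < ∑ i, a i + q) (har : ∑ i, a i < r) :
    shiftedFace r a ∈ (scarfComplex (extremalIdeal k q ^ r)).faces := by
  refine ⟨⟨shiftedFace_nonempty hrq har, fun m hm => ?_⟩, ?_⟩
  · rw [minGens_extremalIdeal_pow]
    obtain ⟨b, rfl, hb, -⟩ := (mem_shiftedFace har.le).1 hm
    exact ⟨b, hb, rfl⟩
  rintro t ⟨-, htI⟩ htl
  rw [minGens_extremalIdeal_pow] at htI
  have hsub : t ⊆ shiftedFace r a := by
    intro m hm
    obtain ⟨b, hb, rfl⟩ := htI hm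
    exact mem_shiftedFace_of_le_label hrq har hb fun A => htl ▸ apply_le_label hm A
  refine hsub.antisymm fun m hm => ?_
  obtain ⟨C, hC, rfl⟩ := exists_eq_add_indicator har.le hm
  have hCne : C.Nonempty := by
    rw [← Finset.card_pos]
    omega
  -- At `x_C` the vertex of `C'` has exponent `∑_C a + |C ∩ C'|`, which reaches `∑_C a + |C|` only
  -- for `C' = C`. So `t` must contain the vertex of `C`.
  have h1 := apply_le_label hm ⟨C, hCne⟩
  rw [epsExp_apply, sum_add_indicator, Finset.inter_self, ← htl] at h1
  dsimp only at h1
  obtain ⟨m', hm', hlt⟩ : ∃ m' ∈ t, ∑ i ∈ C, a i + C.card ≤ m' ⟨C, hCne⟩ := by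
    by_contra! hcon
    have := (label_apply_le_iff t ⟨C, hCne⟩ (∑ i ∈ C, a i + C.card - 1)).2
      fun m' hm' => Nat.le_sub_one_of_lt (hcon m' hm')
    have := hCne.card_pos
    omega
  obtain ⟨C', hC', rfl⟩ := exists_eq_add_indicator har.le (hsub hm')
  rw [epsExp_apply, sum_add_indicator] at hlt
  dsimp only at hlt
  have h2 : C ∩ C' = C :=
    Finset.eq_of_subset_of_card_le Finset.inter_subset_left (by omega)
  have h3 : C = C' :=
    Finset.eq_of_subset_of_card_le (Finset.inter_eq_left.1 h2) (by omega)
  rwa [h3]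

/-- If at least `s` indices have `a i < b i`, any `s` of them serve. Otherwise enlarge the set of
these indices to size `s`: outside it `b ≤ a`, so the whole excess `s` is collected inside. -/
theorem exists_card_eq_le_sum {a b : Fin q → ℕ} {s : ℕ} (hs : s ≤ q)
    (h : ∑ i, b i = ∑ i, a i + s) :
    ∃ C : Finset (Fin q), C.card = s ∧ ∑ i ∈ C, a i + s ≤ ∑ i ∈ C, b i := by
  rcases le_total s ({i | a i < b i} : Finset (Fin q)).card with hP | hP
  · obtain ⟨C, hCP, hC⟩ := Finset.exists_subset_card_eq hP
    refine ⟨C, hC, ?_⟩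
    rw [← hC, Finset.card_eq_sum_ones, ← Finset.sum_add_distrib]
    exact Finset.sum_le_sum fun i hi => (Finset.mem_filter.1 (hCP hi)).2
  · obtain ⟨C, hPC, hC⟩ := Finset.exists_superset_card_eq hP (by simpa using hs)
    refine ⟨C, hC, ?_⟩
    have h1 : ∑ i ∈ Cᶜ, b i ≤ ∑ i ∈ Cᶜ, a i := Finset.sum_le_sum fun i hi => by
      by_contra! hlt
      exact Finset.mem_compl.1 hi (hPC (by simpa using hlt))
    have h2 := Finset.sum_add_sum_compl C a
    have h3 := Finset.sum_add_sum_compl C b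
    omega

/-- Exchange some `x ∈ C` for some `y ∉ C`, chosen so that the intersection with `A` does not
shrink: `x ∉ A` if `A` is a proper subset of `C`, and `y ∈ A` if `A` is not contained in `C`. -/
theorem exists_swap {A C : Finset (Fin q)} (hAC : A ≠ C) (hC : 0 < C.card) (hCq : C.card < q) :
    ∃ C' : Finset (Fin q), C' ≠ C ∧ C'.card = C.card ∧ (A ∩ C).card ≤ (A ∩ C').card := by
  obtain ⟨x, hx, y, hy, hxy⟩ : ∃ x ∈ C, ∃ y, y ∉ C ∧ (x ∈ A → y ∈ A) := by
    by_cases h : A ⊆ C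
    · obtain ⟨x, hx, hxA⟩ := Finset.exists_of_ssubset (h.ssubset_of_ne hAC)
      obtain ⟨y, hy⟩ : ∃ y, y ∉ C := by
        by_contra! hcon
        rw [Finset.eq_univ_iff_forall.2 hcon] at hCq
        simp at hCq
      exact ⟨x, hx, y, hy, fun h => absurd h hxA⟩
    · obtain ⟨y, hyA, hyC⟩ := Finset.not_subset.1 h
      obtain ⟨x, hx⟩ := Finset.card_pos.1 hC
      exact ⟨x, hx, y, hyC, fun _ => hyA⟩
  have hy' : y ∉ C.erase x := fun h => hy (Finset.mem_of_mem_erase h)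
  refine ⟨insert y (C.erase x), fun h => hy (h ▸ Finset.mem_insert_self y _), ?_, ?_⟩
  · rw [Finset.card_insert_of_notMem hy', Finset.card_erase_of_mem hx]
    omega
  · by_cases hxA : x ∈ A
    · rw [Finset.inter_insert_of_mem (hxy hxA), Finset.card_insert_of_notMem (by simp [hy]),
        Finset.inter_erase, Finset.card_erase_of_mem (Finset.mem_inter.2 ⟨hxA, hx⟩)]
      omega
    · refine Finset.card_le_card fun z hz => ?_
      obtain ⟨hzA, hzC⟩ := Finset.mem_inter.1 hz
      refine Finset.mem_inter.2 ⟨hzA, Finset.mem_insert_of_mem (Finset.mem_erase.2 ⟨?_, hzC⟩)⟩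
      rintro rfl
      exact hxA hzA

theorem isFacet_shiftedFace (k : Type*) [Field k] {r : ℕ} {a : Fin q → ℕ}
    (hrq : r < ∑ i, a i + q) (har : ∑ i, a i < r) :
    IsFacet (scarfComplex (extremalIdeal k q ^ r)) (shiftedFace r a) := by
  classical
  refine ⟨shiftedFace_mem_scarfComplex k hrq har, fun G hG hsub => ?_⟩
  intro m hmG
  by_contra hm
  obtain ⟨b, hb, rfl⟩ := (minGens_extremalIdeal_pow k q r).le (hG.1.2 hmG)
  have hb' : ∑ i, b i = r := hb
  obtain ⟨C, hC, hCb⟩ := exists_card_eq_le_sum (a := a) (b := b) (s := r - ∑ i, a i)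
    (by omega) (by omega)
  have hc0 := add_indicator_mem_shiftedFace har.le (C := C) (by omega)
  set c0 := epsExp (fun i => a i + if i ∈ C then 1 else 0) with hc0_def
  have hmc0 : epsExp b ≠ c0 := fun h => hm (h ▸ hc0)
  have hface : insert (epsExp b) (shiftedFace r a) ∈
      (scarfComplex (extremalIdeal k q ^ r)).faces :=
    ((scarfComplex (extremalIdeal k q ^ r)).isRelLowerSet_faces hG).2
      (Finset.insert_subset hmG hsub) (Finset.insert_nonempty _ _)
  have hts : insert (epsExp b) ((shiftedFace r a).erase c0) ⊆
      insert (epsExp b) (shiftedFace r a) :=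
    Finset.insert_subset_insert _ (Finset.erase_subset _ _)
  -- The vertex `c0` is redundant once `ε^b` is present: `ε^b` covers it at `x_C`, and at any other
  -- variable a swapped vertex does. The bounds on `|a|` give `0 < |C| < q`, as swapping requires.
  have hle : c0 ≤ label (insert (epsExp b) ((shiftedFace r a).erase c0)) := by
    intro A
    rw [hc0_def, epsExp_apply, sum_add_indicator]
    by_cases hAC : A.1 = C
    · refine le_trans ?_ (apply_le_label (Finset.mem_insert_self _ _) A)
      rw [epsExp_apply, hAC, Finset.inter_self, hC]
      exact hCb
    · obtain ⟨C', hne, hcard, hle⟩ := exists_swap hAC (by omega) (by omega)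
      have hC' := add_indicator_mem_shiftedFace har.le (C := C') (by omega)
      refine le_trans ?_ (apply_le_label (Finset.mem_insert_of_mem
        (Finset.mem_erase.2 ⟨fun h => hne ?_, hC'⟩)) A)
      · rw [epsExp_apply, sum_add_indicator]
        omega
      · ext i
        have := congrFun (epsExp_injective h) i
        split_ifs at this <;> first | omega | simp_all
  have heq := hface.2 (insert (epsExp b) ((shiftedFace r a).erase c0))
    ⟨Finset.insert_nonempty _ _, fun x hx => hface.1.2 (hts hx)⟩
    (le_antisymm (Finset.sup_mono hts) (Finset.sup_le fun x hx => by
      rcases Finset.mem_insert.1 hx with rfl | hx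
      · exact Finset.le_sup (f := id) (Finset.mem_insert_self _ _)
      · by_cases hxc : x = c0
        · exact hxc ▸ hle
        · exact Finset.le_sup (f := id) (Finset.mem_insert_of_mem (Finset.mem_erase.2 ⟨hxc, hx⟩))))
  have := heq.ge (Finset.mem_insert_of_mem hc0)
  simp [hmc0.symm] at this

/-- For `q = 1` no `a` satisfies `r - q < |a| < r`; this case is settled directly, the ideal having
a single generator. -/
theorem scarfComplex_faces_one (k : Type*) [Field k] (r : ℕ) :
    (scarfComplex (extremalIdeal k 1 ^ r)).faces = {{epsExp fun _ => r}} := by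
  have hgen : minGens (extremalIdeal k 1 ^ r) = {epsExp fun _ => r} := by
    rw [minGens_extremalIdeal_pow, ← Set.image_singleton]
    congr 1
    ext a
    simp [funext_iff]
  have htaylor (s) : s ∈ (taylorComplex (extremalIdeal k 1 ^ r)).faces ↔
      s = {epsExp fun _ => r} := by
    change s.Nonempty ∧ _ ↔ _
    rw [hgen, ← Finset.coe_singleton, Finset.coe_subset]
    exact ⟨fun h => h.1.subset_singleton_iff.1 h.2, fun h => by simp [h]⟩
  ext s
  change s ∈ (taylorComplex _).faces ∧ (∀ t ∈ (taylorComplex _).faces, _) ↔ _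
  simp only [htaylor, Set.mem_singleton_iff]
  exact ⟨fun h => h.1, fun h => ⟨h, fun t ht _ => ht.trans h.symm⟩⟩

theorem uComplex_faces_one (r : ℕ) : (uComplex 1 r).faces = {{epsExp fun _ => r}} := by
  ext s
  simp only [uComplex, generatedBy, if_true, Set.mem_singleton_iff, exists_eq_left,
    Set.mem_ofPred_eq]
  exact ⟨fun h => h.1.subset_singleton_iff.1 h.2, fun h => by simp [h]⟩

theorem mem_uComplex_faces {r : ℕ} (hq : q ≠ 1) {s : Finset (Var q →₀ ℕ)} :
    s ∈ (uComplex q r).faces ↔ s.Nonempty ∧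
      ∃ a : Fin q → ℕ, r < ∑ i, a i + q ∧ ∑ i, a i < r ∧ s ⊆ shiftedFace r a := by
  simp only [uComplex, generatedBy, if_neg hq, Set.mem_ofPred_eq]
  refine and_congr_right fun _ => ⟨?_, ?_⟩
  · rintro ⟨_, ⟨a, h1, h2, rfl⟩, h⟩
    exact ⟨a, h1, h2, h⟩
  · rintro ⟨a, h1, h2, h⟩
    exact ⟨_, ⟨a, h1, h2, rfl⟩, h⟩

theorem uComplex_le_scarfComplex (k : Type*) [Field k] (q r : ℕ) :
    uComplex q r ≤ scarfComplex (extremalIdeal k q ^ r) := by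
  change (uComplex q r).faces ⊆ _
  rcases eq_or_ne q 1 with rfl | hq
  · rw [uComplex_faces_one, scarfComplex_faces_one]
  · intro s hs
    obtain ⟨hne, a, h1, h2, h⟩ := (mem_uComplex_faces hq).1 hs
    exact ((scarfComplex _).isRelLowerSet_faces (shiftedFace_mem_scarfComplex k h1 h2)).2 h hne

theorem isFacet_scarfComplex_of_isFacet_uComplex (k : Type*) [Field k] {r : ℕ}
    {F : Finset (Var q →₀ ℕ)} (hF : IsFacet (uComplex q r) F) :
    IsFacet (scarfComplex (extremalIdeal k q ^ r)) F := by
  rcases eq_or_ne q 1 with rfl | hq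
  · unfold IsFacet at hF ⊢
    rwa [scarfComplex_faces_one, ← uComplex_faces_one]
  · obtain ⟨hne, a, h1, h2, h⟩ := (mem_uComplex_faces hq).1 hF.1
    -- A facet contained in a generating face equals it by maximality.
    have := hF.2 ((mem_uComplex_faces hq).2
      ⟨shiftedFace_nonempty h1 h2, a, h1, h2, Finset.Subset.refl _⟩) h
    rw [h.antisymm this]
    exact isFacet_shiftedFace k h1 h2

end Combinatorics
end ExtremalScarf

theorem theoremt {k : Type*} [Field k] (q r : ℕ) (hq : 1 ≤ q) (hr : 1 ≤ r) :
    (∀ a : Fin q → ℕ, r < ∑ i, a i + q → ∑ i, a i < r →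
      ExtremalScarf.IsFacet (ExtremalScarf.scarfComplex (ExtremalScarf.extremalIdeal k q ^ r))
        (ExtremalScarf.shiftedFace r a)) ∧
    (∀ F, ExtremalScarf.IsFacet (ExtremalScarf.uComplex q r) F →
      ExtremalScarf.IsFacet (ExtremalScarf.scarfComplex (ExtremalScarf.extremalIdeal k q ^ r)) F) ∧
    ExtremalScarf.uComplex q r ≤
      ExtremalScarf.scarfComplex (ExtremalScarf.extremalIdeal k q ^ r) ∧
    ∀ i : ℕ, ExtremalScarf.fNumber (ExtremalScarf.uComplex q r) i ≤
      (ExtremalScarf.betti i (ExtremalScarf.extremalIdeal k q ^ r) : ℕ∞) := by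
  refine ⟨fun a h1 h2 => ExtremalScarf.isFacet_shiftedFace k h1 h2,
    fun F hF => ExtremalScarf.isFacet_scarfComplex_of_isFacet_uComplex k hF,
    ExtremalScarf.uComplex_le_scarfComplex k q r, fun i => ?_⟩
  refine le_trans (Set.encard_le_encard (Set.ofPred_subset_ofPred.2 fun s hs =>
    ⟨ExtremalScarf.uComplex_le_scarfComplex k q r hs.1, hs.2⟩))
    (ExtremalScarf.fNumber_scarfComplex_le_betti k _ _
      (ExtremalScarf.coe_minGens_finset k q r) ?_ i)
  rw [ExtremalScarf.coe_minGens_finset k, ExtremalScarf.minGens_extremalIdeal_pow,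
    ExtremalScarf.extremalIdeal_pow]
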